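/- Let $\mathcal K$ be a separable complex Hilbert space and let $J$ be a fundamental symmetry on it, that is, a selfadjoint unitary operator. Let $N_\pm\in\{0,1,2,\dots,\infty\}$ be the dimension of $\mathrm{Ker}(J\mp\mathbf 1)$. A bounded operator $H$ on $\mathcal K$ is called $J$-hermitian if $H^*J=JH$, and a $J$-hermitian $H$ is called $\mathbb R$-Fredholm if $H-\lambda\mathbf 1$ is a Fredholm operator for every $\lambda\in\mathbb R$. Let $\mathbb{FH}(\mathcal K,J)$ be the set of all $J$-hermitian $\mathbb R$-Fredholm operators; the real spectrum of each of them consists of finitely many isolated eigenvalues of finite algebraic multiplicity. For $H\in\mathbb{FH}(\mathcal K,J)$ and $\lambda\in\sigma(H)\cap\mathbb R$, let $\mathcal E_\lambda(H)$ be the range of the Riesz projection $\frac{1}{2\pi\imath}\oint(z-H)^{-1}\,dz$ (integral over a small circle around $\lambda$), and let $\mathrm{Sig}(\lambda,H)=\nu_+(\lambda,H)-\nu_-(\lambda,H)$, where $\nu_\pm(\lambda,H)$ is the number, counted with multiplicity, of positive/negative eigenvalues of the hermitian form $(v,w)\mapsto\langle v,Jw\rangle$ on $\mathcal E_\lambda(H)$.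 The global Krein signature of $H$ is $\mathrm{Sig}(H)=\sum_{\lambda\in\sigma(H)\cap\mathbb R}\mathrm{Sig}(\lambda,H)\in\mathbb Z$. For $n\in\mathbb Z$ put $\mathbb{FH}_n(\mathcal K,J)=\{H\in\mathbb{FH}(\mathcal K,J):\mathrm{Sig}(H)=n\}$. (i) If both $N_+$ and $N_-$ are finite, then $\mathbb{FH}(\mathcal K,J)=\mathbb{FH}_n(\mathcal K,J)$ with $n=N_+-N_-$; that is, every $J$-hermitian $\mathbb R$-Fredholm operator has global signature $N_+-N_-$. (ii) If one of $N_+$, $N_-$ is finite and the other is infinite, then $\mathbb{FH}(\mathcal K,J)=\emptyset$. -/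

import Mathlib

open scoped InnerProductSpace Topology

noncomputable section

namespace Krein

variable {K : Type*} [NormedAddCommGroup K] [InnerProductSpace ℂ K] [CompleteSpace K]

/-- A fundamental symmetry on a Hilbert space: a selfadjoint unitary operator. -/
def IsFundamentalSymmetry (J : K →L[ℂ] K) : Prop :=
  IsSelfAdjoint J ∧ J ∈ unitary (K →L[ℂ] K)

/-- The eigenspace of `J` for the eigenvalue `1`; its dimension is `N₊`. -/
def plusSpace (J : K →L[ℂ] K) : Submodule ℂ K :=
  Module.End.eigenspace (J : K →ₗ[ℂ] K) 1

/-- The eigenspace of `J` for the eigenvalue `-1`; its dimension is `N₋`. -/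
def minusSpace (J : K →L[ℂ] K) : Submodule ℂ K :=
  Module.End.eigenspace (J : K →ₗ[ℂ] K) (-1)

/-- `H` is `J`-hermitian: `H* J = J H`. -/
def IsJHermitian (J H : K →L[ℂ] K) : Prop :=
  ContinuousLinearMap.adjoint H * J = J * H

/-- The set of `ℝ`-Fredholm `J`-hermitian operators: `H - λ 1` is Fredholm for every real `λ`. -/
def realFredholm (J : K →L[ℂ] K) : Set (K →L[ℂ] K) :=
  {H | IsJHermitian J H ∧
    ∀ t : ℝ, ContinuousLinearMap.IsFredholm (H - (t : ℂ) • (1 : K →L[ℂ] K))}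

/-- The Riesz projection of `A` at an isolated point `z₀` of the spectrum (or a point of the
resolvent set), `(2πi)⁻¹ ∮ (z - A)⁻¹ dz` over small positively oriented circles around `z₀`. The
integral does not depend on the radius once the closed disc contains no other point of the
spectrum, so the limit is the common value of these integrals. -/
def rieszProjection (A : K →L[ℂ] K) (z₀ : ℂ) : K →L[ℂ] K :=
  Filter.limUnder (𝓝[>] (0 : ℝ)) fun r : ℝ =>
    (2 * (Real.pi : ℂ) * Complex.I)⁻¹ • ∮ z in C(z₀, r), resolvent A z

/-- The spectral subspace of `A` at `z₀`, the range of the Riesz projection. -/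
def spectralSpace (A : K →L[ℂ] K) (z₀ : ℂ) : Submodule ℂ K :=
  LinearMap.range (rieszProjection A z₀ : K →ₗ[ℂ] K)

/-- The eigenspace for `μ` of the hermitian form `(v, w) ↦ ⟪v, J w⟫` restricted to the subspace
`E`, that is, of the compression of `J` to `E`. -/
def formEigenspace (J : K →L[ℂ] K) (E : Submodule ℂ K) (μ : ℝ) : Submodule ℂ K where
  carrier := {v | v ∈ E ∧ ∀ w ∈ E, ⟪w, J v⟫_ℂ = (μ : ℂ) * ⟪w, v⟫_ℂ}
  zero_mem' := ⟨E.zero_mem, fun w _ => by simp⟩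
  add_mem' := by
    rintro a b ⟨ha, ha'⟩ ⟨hb, hb'⟩
    refine ⟨E.add_mem ha hb, fun w hw => ?_⟩
    rw [map_add, inner_add_right, inner_add_right, ha' w hw, hb' w hw, mul_add]
  smul_mem' := by
    rintro c a ⟨ha, ha'⟩
    refine ⟨E.smul_mem c ha, fun w hw => ?_⟩
    rw [map_smul, inner_smul_right, inner_smul_right, ha' w hw, mul_left_comm]

/-- The number of positive eigenvalues, with multiplicity, of the hermitian form `J` on the
finite dimensional subspace `E`. -/
def inertiaPos (J : K →L[ℂ] K) (E : Submodule ℂ K) : ℕ :=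
  Module.finrank ℂ (⨆ μ : {μ : ℝ // 0 < μ}, formEigenspace J E μ : Submodule ℂ K)

/-- The number of negative eigenvalues, with multiplicity, of the hermitian form `J` on the
finite dimensional subspace `E`. -/
def inertiaNeg (J : K →L[ℂ] K) (E : Submodule ℂ K) : ℕ :=
  Module.finrank ℂ (⨆ μ : {μ : ℝ // μ < 0}, formEigenspace J E μ : Submodule ℂ K)

/-- The Krein signature of `H` at the real point `t` (it is `0` if `t` is not in the spectrum). -/
def kreinSignature (J H : K →L[ℂ] K) (t : ℝ) : ℤ :=
  (inertiaPos J (spectralSpace H t) : ℤ) - (inertiaNeg J (spectralSpace H t) : ℤ)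

/-- The global Krein signature: the sum of the Krein signatures over the real line. The sum has
only finitely many nonzero terms when the real spectrum of `H` is discrete. -/
def globalSignature (J H : K →L[ℂ] K) : ℤ :=
  ∑ᶠ t : ℝ, kreinSignature J H t

/-- The set of `ℝ`-Fredholm `J`-hermitian operators with global signature `n`. -/
def realFredholmOfSignature (J : K →L[ℂ] K) (n : ℤ) : Set (K →L[ℂ] K) :=
  {H | H ∈ realFredholm J ∧ globalSignature J H = n}

end Krein

end

/-! For (ii), if one eigenspace of `J` is finite dimensional then `J = c + F` with `c = ∓1` and `F`
of finite rank, so `H* J = J H` makes `H* - H` of finite rank. The selfadjoint part of `H` then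
differs from `H` by finite rank, and all its real translates are Fredholm. A selfadjoint operator
with this property has only isolated spectral points, each with finite dimensional kernel;
compactness leaves finitely many of them, so the space is finite dimensional, contradicting the
infinite eigenspace (`finiteDimensional_of_isSelfAdjoint_of_isFredholm`,
`finiteDimensional_of_sub_finiteRange`).

For (i), `K` is the sum of the two eigenspaces of `J`, hence finite dimensional, and Riesz ranges
are generalized eigenspaces (`spectralSpace_eq_maxGenEigenspace`). Those for `a` and `b` are
`J`-orthogonal unless `a` is conjugate to `b` (`inner_maxGenEigenspace_eq_zero`). So `K` is the
`J`-orthogonal sum of the generalized eigenspaces at real eigenvalues and of one nonreal block `U ⊔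
L`, where `U` and `L` collect the upper and lower half planes. Both are isotropic, so the block has
signature zero (`formSignature_sup_of_isotropic`). By additivity the global signature is that of `J`
on `K`, namely `N₊ - N₋` (`formSignature_top`). -/

namespace Krein

/-! ### Fredholm perturbation and the emptiness statement. -/

section Fredholm

variable {K : Type*} [NormedAddCommGroup K] [InnerProductSpace ℂ K]

/-- Fredholm operators are stable under perturbations of finite rank. -/
theorem isFredholm_of_hasFiniteRange_sub {u v : K →L[ℂ] K} (hu : u.IsFredholm)
    (h : ((v - u : K →L[ℂ] K) : K →ₗ[ℂ] K).HasFiniteRange) : v.IsFredholm := by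
  open LinearMap.FiniteRangeSetoid in
  obtain ⟨w, hwu, huw⟩ := hu.exists_isQuasiInverse
  have e : (v : K →ₗ[ℂ] K) ≈ (u : K →ₗ[ℂ] K) :=
    equiv_iff_hasFiniteRange.2 (by simpa using h)
  exact .of_isQuasiInverse (v := w)
    ⟨Setoid.trans (equiv_comp_left e) hwu, Setoid.trans (equiv_comp_right e) huw⟩

/-- The element acts as the identity on `ker p` and as `c` on `range p`; replacing `c` by `c⁻¹`
inverts it. -/
theorem isUnit_one_sub_add_smul {A : Type*} [Ring A] [Algebra ℂ A] {p : A} (hp : p * p = p)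
    {c : ℂ} (hc : c ≠ 0) : IsUnit (1 - p + c • p) := by
  have key : ∀ a b : ℂ, a * b = 1 → (1 - p + a • p) * (1 - p + b • p) = 1 := by
    intro a b hab
    simp only [mul_add, add_mul, mul_sub, sub_mul, smul_mul_assoc, mul_smul_comm, hp, one_mul,
      mul_one, sub_self, zero_add]
    rw [smul_smul, mul_comm b a, hab, one_smul]
    abel
  exact ⟨⟨_, _, key c c⁻¹ (mul_inv_cancel₀ hc), key c⁻¹ c (inv_mul_cancel₀ hc)⟩, rfl⟩

theorem mem_plusSpace {J : K →L[ℂ] K} {v : K} : v ∈ plusSpace J ↔ J v = v := by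
  simp [plusSpace]

theorem mem_minusSpace {J : K →L[ℂ] K} {v : K} : v ∈ minusSpace J ↔ J v = -v := by
  simp [minusSpace]

variable [CompleteSpace K]

/-- Zero is at most an isolated point of the spectrum of a selfadjoint Fredholm operator. -/
theorem eventually_isUnit_sub_of_isSelfAdjoint_of_isFredholm {T : K →L[ℂ] K}
    (hT : IsSelfAdjoint T) (hF : T.IsFredholm) :
    ∀ᶠ s : ℂ in 𝓝[≠] 0, IsUnit (T - s • (1 : K →L[ℂ] K)) := by
  have := hF.finite_ker
  set N : Submodule ℂ K := (T : K →ₗ[ℂ] K).ker with hN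
  set P : K →L[ℂ] K := N.starProjection with hP
  have hPP : P * P = P := N.isIdempotentElem_starProjection
  have hTP : T * P = 0 := by
    ext x
    exact N.starProjection_apply_mem x
  have hPT : P * T = 0 := by
    have := congrArg star hTP
    rwa [star_mul, hT.star_eq, (isSelfAdjoint_starProjection N).star_eq, star_zero] at this
  -- A Fredholm operator has closed range, so selfadjointness makes the range the full orthogonal
  -- complement of the kernel.
  have hrange : (Nᗮ : Submodule ℂ K) = (T : K →ₗ[ℂ] K).range := by
    have h1 : ((T : K →ₗ[ℂ] K).range)ᗮ = N := by
      have := ContinuousLinearMap.orthogonal_range T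
      rw [show ContinuousLinearMap.adjoint T = T from hT.star_eq] at this
      exact this
    have hcl : IsClosed ((T : K →ₗ[ℂ] K).range : Set K) := hF.isClosed_range
    have := hcl.completeSpace_coe
    rw [← h1, Submodule.orthogonal_orthogonal]
  have hS : IsUnit (T + P) := by
    rw [ContinuousLinearMap.isUnit_iff_bijective]
    constructor
    · rw [injective_iff_map_eq_zero]
      intro x hx
      have hPx : P x = 0 := by
        have := congrArg P hx
        have h2 : P (T x) = 0 := by simpa using congrArg (fun f : K →L[ℂ] K => f x) hPT
        have h3 : P (P x) = P x := by simpa using congrArg (fun f : K →L[ℂ] K => f x) hPP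
        simpa [h2, h3] using this
      have hTx : x ∈ N := by
        have : T x = 0 := by simpa [hPx] using hx
        exact this
      rw [← hPx]
      exact (Submodule.starProjection_eq_self_iff.2 hTx).symm
    · intro y
      have hy : y - P y ∈ (Nᗮ : Submodule ℂ K) := N.sub_starProjection_mem_orthogonal y
      rw [hrange] at hy
      obtain ⟨x, hx⟩ := hy
      -- `T` sends this vector to `T x = y - P y`, and `P` sends it to `P y`.
      refine ⟨x - P x + P y, ?_⟩
      have a : ∀ z, T (P z) = 0 := fun z => by
        simpa using congrArg (fun f : K →L[ℂ] K => f z) hTP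
      have b : ∀ z, P (P z) = P z := fun z => by
        simpa using congrArg (fun f : K →L[ℂ] K => f z) hPP
      have hx' : T x = y - P y := hx
      simp [a, b, hx']
  have hcont : Continuous fun s : ℂ => T + P - s • (1 : K →L[ℂ] K) := by fun_prop
  have h0 : ∀ᶠ s : ℂ in 𝓝 0, IsUnit (T + P - s • (1 : K →L[ℂ] K)) := by
    refine hcont.continuousAt.eventually_mem (Units.isOpen.mem_nhds ?_)
    simpa using hS
  have h1 : ∀ᶠ s : ℂ in 𝓝 0, s ≠ 1 := isOpen_ne.mem_nhds zero_ne_one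
  filter_upwards [h0.filter_mono nhdsWithin_le_nhds, h1.filter_mono nhdsWithin_le_nhds,
    self_mem_nhdsWithin] with s hs hs1 hs0
  have h1s : (1 - s) ≠ 0 := sub_ne_zero.2 (Ne.symm hs1)
  have hc : -s / (1 - s) ≠ 0 := div_ne_zero (neg_ne_zero.2 hs0) h1s
  -- `T - s` and `T + P - s` agree on `Nᗮ`; on `N` they are `-s` and `1 - s`, and the second factor
  -- corrects by the quotient.
  have : T - s • (1 : K →L[ℂ] K) =
      (T + P - s • (1 : K →L[ℂ] K)) * (1 - P + (-s / (1 - s)) • P) := by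
    have e : (-s / (1 - s)) • (P - s • P) = -(s • P) := by
      rw [smul_sub, smul_smul, ← sub_smul, ← neg_smul]
      congr 1
      field_simp
      ring
    simp only [mul_add, add_mul, mul_sub, sub_mul, smul_mul_assoc, mul_smul_comm, hPP, hTP,
      one_mul, mul_one, zero_add]
    rw [e]
    abel
  rw [this]
  exact hs.mul (isUnit_one_sub_add_smul hPP hc)

/-- The kernel of a product `B C` is the preimage under `C` of `ker B`, and a preimage of a finite
dimensional space under a map with finite dimensional kernel is finite dimensional. -/
theorem finiteDimensional_ker_aeval_prod {V : Type*} [AddCommGroup V] [Module ℂ V]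
    (A : Module.End ℂ V) (s : Finset ℂ)
    (h : ∀ z ∈ s, FiniteDimensional ℂ (A - algebraMap ℂ (Module.End ℂ V) z).ker) :
    FiniteDimensional ℂ
      (Polynomial.aeval A (∏ z ∈ s, (Polynomial.X - Polynomial.C z))).ker := by
  classical
  induction s using Finset.induction_on with
  | empty =>
    have : (Polynomial.aeval A (∏ z ∈ (∅ : Finset ℂ), (Polynomial.X - Polynomial.C z))).ker = ⊥ := by
      rw [Finset.prod_empty, map_one]
      exact LinearMap.ker_id
    rw [this]
    infer_instance
  | insert a s ha ih =>
    have := ih fun z hz => h z (Finset.mem_insert_of_mem hz)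
    have := h a (Finset.mem_insert_self _ _)
    have e : (Polynomial.aeval A (∏ z ∈ insert a s, (Polynomial.X - Polynomial.C z))).ker =
        (A - algebraMap ℂ (Module.End ℂ V) a).ker.comap
          (Polynomial.aeval A (∏ z ∈ s, (Polynomial.X - Polynomial.C z))) := by
      rw [Finset.prod_insert ha, map_mul, Module.End.mul_eq_comp, LinearMap.ker_comp]
      simp
    rw [e]
    infer_instance

/-- A selfadjoint operator with empty essential spectrum acts on a finite dimensional space. -/
theorem finiteDimensional_of_isSelfAdjoint_of_isFredholm {A : K →L[ℂ] K} (hA : IsSelfAdjoint A)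
    (hF : ∀ t : ℝ, (A - (t : ℂ) • (1 : K →L[ℂ] K)).IsFredholm) : FiniteDimensional ℂ K := by
  -- An infinite compact spectrum would accumulate at one of its own points, which is real, against
  -- the isolation of zero for the translate of `A`.
  have hfin : (spectrum ℂ A).Finite := by
    by_contra hinf
    obtain ⟨z, hz, hacc⟩ := Set.Infinite.exists_accPt_of_subset_isCompact hinf
      (spectrum.isCompact A) subset_rfl
    have hzr : z = (z.re : ℂ) := hA.mem_spectrum_eq_re hz
    have hsa : IsSelfAdjoint (A - (z.re : ℂ) • (1 : K →L[ℂ] K)) := by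
      refine hA.sub (IsSelfAdjoint.smul ?_ (.one _))
      exact Complex.conj_ofReal _
    have hev := eventually_isUnit_sub_of_isSelfAdjoint_of_isFredholm hsa (hF z.re)
    rw [← hzr] at hev
    have htend : Filter.Tendsto (fun w : ℂ => w - z) (𝓝[≠] z) (𝓝[≠] 0) := by
      refine tendsto_nhdsWithin_iff.2 ⟨?_, ?_⟩
      · have : ContinuousAt (fun w : ℂ => w - z) z := by fun_prop
        have := this.tendsto
        rw [sub_self] at this
        exact this.mono_left nhdsWithin_le_nhds
      · filter_upwards [self_mem_nhdsWithin] with w hw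
        exact sub_ne_zero.2 hw
    have hev2 := htend.eventually hev
    obtain ⟨w, hw, hw2⟩ := ((accPt_iff_frequently_nhdsNE.1 hacc).and_eventually hev2).exists
    apply hw
    rw [spectrum.mem_resolventSet_iff, ← IsUnit.neg_iff]
    convert hw2 using 1
    rw [Algebra.algebraMap_eq_smul_one, sub_smul]
    abel
  -- `p` vanishes on the spectrum, so `p(A) = 0` by functional calculus and its finite dimensional
  -- kernel is everything.
  set p : Polynomial ℂ := ∏ z ∈ hfin.toFinset, (Polynomial.X - Polynomial.C z) with hp
  have hp0 : Polynomial.aeval A p = 0 := by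
    rw [← cfc_polynomial p A hA.isStarNormal, ← cfc_zero ℂ A]
    refine cfc_congr fun z hz => ?_
    simp only [hp, Polynomial.eval_prod, Pi.zero_apply]
    exact Finset.prod_eq_zero (hfin.mem_toFinset.2 hz) (by simp)
  have hker := finiteDimensional_ker_aeval_prod (A : K →ₗ[ℂ] K) hfin.toFinset (by
    intro z hz
    have hzr : z = (z.re : ℂ) := hA.mem_spectrum_eq_re (hfin.mem_toFinset.1 hz)
    have := (hF z.re).finite_ker
    rw [← hzr] at this
    exact this)
  have h0 : Polynomial.aeval (A : K →ₗ[ℂ] K) p = 0 := by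
    have := Polynomial.aeval_algHom_apply
      ({ ContinuousLinearMap.toLinearMapRingHom with commutes' := fun _ => rfl } :
        (K →L[ℂ] K) →ₐ[ℂ] Module.End ℂ K) A p
    rw [hp0, map_zero] at this
    exact this
  rw [← hp, h0, LinearMap.ker_zero] at hker
  exact Module.Finite.equiv (Submodule.topEquiv : (⊤ : Submodule ℂ K) ≃ₗ[ℂ] K)

/-- With `F = J - c`, the relation `H* J = J H` reads `c (H* - H) = F H - H* F`, which has finite
rank. Thus `A = (H + H*) / 2` is a finite rank perturbation of `H`. -/
theorem finiteDimensional_of_sub_finiteRange {J H : K →L[ℂ] K} (c : ℂ) (hc : c ≠ 0)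
    (hJ : ((J - c • (1 : K →L[ℂ] K) : K →L[ℂ] K) : K →ₗ[ℂ] K).HasFiniteRange)
    (hH : H ∈ realFredholm J) : FiniteDimensional ℂ K := by
  obtain ⟨hherm, hF⟩ := hH
  set A : K →L[ℂ] K := (2⁻¹ : ℂ) • (H + ContinuousLinearMap.adjoint H) with hAdef
  have hA : IsSelfAdjoint A := by
    have h2 : IsSelfAdjoint (2⁻¹ : ℂ) := by
      rw [isSelfAdjoint_iff]; simp
    refine h2.smul ?_
    exact IsSelfAdjoint.add_star_self H
  have hdiff : A - H = (2⁻¹ * c⁻¹) • ((J - c • (1 : K →L[ℂ] K)) * H -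
      ContinuousLinearMap.adjoint H * (J - c • (1 : K →L[ℂ] K))) := by
    have hh : ContinuousLinearMap.adjoint H * J = J * H := hherm
    simp only [mul_sub, sub_mul, smul_mul_assoc, mul_smul_comm, one_mul, mul_one, hh]
    rw [sub_sub_sub_cancel_left, ← smul_sub, smul_smul, mul_assoc, inv_mul_cancel₀ hc, mul_one,
      hAdef]
    module
  refine finiteDimensional_of_isSelfAdjoint_of_isFredholm hA fun t => ?_
  refine isFredholm_of_hasFiniteRange_sub (hF t) ?_
  rw [sub_sub_sub_cancel_right, hdiff]
  exact ((hJ.comp_right (H : K →ₗ[ℂ] K)).sub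
    (hJ.comp_left (ContinuousLinearMap.adjoint H : K →ₗ[ℂ] K))).smul _

theorem IsFundamentalSymmetry.mul_self {J : K →L[ℂ] K} (hJ : IsFundamentalSymmetry J) :
    J * J = 1 := by
  have := hJ.2.1
  rwa [hJ.1.star_eq] at this

theorem IsFundamentalSymmetry.apply_apply {J : K →L[ℂ] K} (hJ : IsFundamentalSymmetry J) (v : K) :
    J (J v) = v := by
  simpa using congrArg (fun f : K →L[ℂ] K => f v) hJ.mul_self

theorem IsFundamentalSymmetry.sup_eq_top {J : K →L[ℂ] K} (hJ : IsFundamentalSymmetry J) :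
    plusSpace J ⊔ minusSpace J = ⊤ := by
  refine eq_top_iff.2 fun v _ => ?_
  refine Submodule.mem_sup.2 ⟨(2⁻¹ : ℂ) • (v + J v), ?_, (2⁻¹ : ℂ) • (v - J v), ?_, ?_⟩
  · rw [mem_plusSpace, map_smul, map_add, hJ.apply_apply, add_comm]
  · rw [mem_minusSpace, map_smul, map_sub, hJ.apply_apply, ← smul_neg, neg_sub]
  · module

/-- If exactly one of the eigenspaces of `J` is finite dimensional, there is no `ℝ`-Fredholm
`J`-hermitian operator. -/
theorem realFredholm_eq_empty {J : K →L[ℂ] K} (hJ : IsFundamentalSymmetry J)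
    (h : (FiniteDimensional ℂ (plusSpace J) ∧ ¬ FiniteDimensional ℂ (minusSpace J)) ∨
      (¬ FiniteDimensional ℂ (plusSpace J) ∧ FiniteDimensional ℂ (minusSpace J))) :
    realFredholm J = ∅ := by
  refine Set.eq_empty_of_forall_notMem fun H hH => ?_
  rcases h with ⟨hp, hm⟩ | ⟨hp, hm⟩
  · refine hm ?_
    -- Since `J² = 1`, the range of `J + 1` lies in the `+1` eigenspace.
    have := finiteDimensional_of_sub_finiteRange (-1) (by norm_num) (J := J) (H := H) ?_ hH
    · infer_instance
    · have : (((J - (-1 : ℂ) • (1 : K →L[ℂ] K) : K →L[ℂ] K) : K →ₗ[ℂ] K)).range ≤ plusSpace J := by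
        rintro _ ⟨v, rfl⟩
        simp [mem_plusSpace, hJ.apply_apply, add_comm]
      exact Submodule.fg_iff_finiteDimensional _ |>.2 (Submodule.finiteDimensional_of_le this)
  · refine hp ?_
    have := finiteDimensional_of_sub_finiteRange 1 one_ne_zero (J := J) (H := H) ?_ hH
    · infer_instance
    · have : (((J - (1 : ℂ) • (1 : K →L[ℂ] K) : K →L[ℂ] K) : K →ₗ[ℂ] K)).range ≤ minusSpace J := by
        rintro _ ⟨v, rfl⟩
        simp [mem_minusSpace, hJ.apply_apply]
      exact Submodule.fg_iff_finiteDimensional _ |>.2 (Submodule.finiteDimensional_of_le this)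

end Fredholm

/-! ### Inertia and signature of the hermitian form on a subspace. -/

section Inertia

variable {K : Type*} [NormedAddCommGroup K] [InnerProductSpace ℂ K]

theorem mem_formEigenspace {J : K →L[ℂ] K} {E : Submodule ℂ K} {μ : ℝ} {v : K} :
    v ∈ formEigenspace J E μ ↔ v ∈ E ∧ ∀ w ∈ E, ⟪w, J v⟫_ℂ = (μ : ℂ) * ⟪w, v⟫_ℂ :=
  Iff.rfl

theorem formEigenspace_le (J : K →L[ℂ] K) (E : Submodule ℂ K) (μ : ℝ) :
    formEigenspace J E μ ≤ E :=
  fun _ hv => hv.1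

theorem formEigenspace_neg (J : K →L[ℂ] K) (E : Submodule ℂ K) (μ : ℝ) :
    formEigenspace (-J) E μ = formEigenspace J E (-μ) := by
  ext v
  simp only [mem_formEigenspace, neg_apply, inner_neg_right,
    Complex.ofReal_neg, neg_mul, neg_eq_iff_eq_neg]

/-- The span of the eigenspaces of the form whose eigenvalue satisfies `p`. -/
def formSpan (J : K →L[ℂ] K) (E : Submodule ℂ K) (p : ℝ → Prop) : Submodule ℂ K :=
  ⨆ μ : {μ : ℝ // p μ}, formEigenspace J E μ

theorem formSpan_le (J : K →L[ℂ] K) (E : Submodule ℂ K) (p : ℝ → Prop) : formSpan J E p ≤ E :=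
  iSup_le fun _ => formEigenspace_le _ _ _

theorem inertiaNeg_eq_inertiaPos_neg (J : K →L[ℂ] K) (E : Submodule ℂ K) :
    inertiaNeg J E = inertiaPos (-J) E := by
  have : (⨆ μ : {μ : ℝ // μ < 0}, formEigenspace J E μ) =
      ⨆ μ : {μ : ℝ // 0 < μ}, formEigenspace (-J) E μ := by
    refine le_antisymm (iSup_le fun μ => ?_) (iSup_le fun μ => ?_)
    · refine le_trans (le_of_eq ?_) (le_iSup _ (⟨-μ.1, neg_pos.2 μ.2⟩ : {μ : ℝ // 0 < μ}))
      rw [formEigenspace_neg, neg_neg]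
    · rw [formEigenspace_neg]
      exact le_iSup (fun μ : {μ : ℝ // μ < 0} => formEigenspace J E μ) ⟨-μ.1, neg_neg_of_pos μ.2⟩
  rw [inertiaNeg, this, inertiaPos]

theorem inner_apply_comm [CompleteSpace K] {J : K →L[ℂ] K} (hJ : IsSelfAdjoint J) (v w : K) :
    ⟪J v, w⟫_ℂ = ⟪v, J w⟫_ℂ := by
  have := ContinuousLinearMap.adjoint_inner_right J v w
  rw [← this]
  congr 1
  exact congrArg (fun f : K →L[ℂ] K => f w) hJ.star_eq

theorem inner_formEigenspace_eq_zero [CompleteSpace K] {J : K →L[ℂ] K} (hJ : IsSelfAdjoint J)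
    {E : Submodule ℂ K} {μ ν : ℝ} (h : μ ≠ ν) {v w : K} (hv : v ∈ formEigenspace J E μ)
    (hw : w ∈ formEigenspace J E ν) : ⟪v, w⟫_ℂ = 0 := by
  have h1 := hw.2 v hv.1
  have h2 := congrArg (starRingEnd ℂ) (hv.2 w hw.1)
  rw [inner_conj_symm, map_mul, inner_conj_symm, Complex.conj_ofReal, inner_apply_comm hJ, h1] at h2
  have h3 : ((μ : ℂ) - ν) * ⟪v, w⟫_ℂ = 0 := by linear_combination -h2
  refine (mul_eq_zero.1 h3).resolve_left ?_
  exact_mod_cast sub_ne_zero.2 h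

/-- The form on a sum of eigenvectors is a weighted sum of squares. -/
theorem exists_re_inner_eq_sum [CompleteSpace K] {J : K →L[ℂ] K} (hJ : IsSelfAdjoint J)
    {E : Submodule ℂ K} {p : ℝ → Prop} {v : K} (hv : v ∈ formSpan J E p) :
    ∃ (s : Finset {μ : ℝ // p μ}) (f : {μ : ℝ // p μ} → K), v = ∑ μ ∈ s, f μ ∧
      RCLike.re ⟪v, J v⟫_ℂ = ∑ μ ∈ s, μ.1 * ‖f μ‖ ^ 2 := by
  classical
  obtain ⟨f, hf, rfl⟩ := (Submodule.mem_iSup_iff_exists_finsupp _ _).1 hv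
  refine ⟨f.support, f, rfl, ?_⟩
  rw [Finsupp.sum]
  have : ⟪∑ i ∈ f.support, f i, J (∑ i ∈ f.support, f i)⟫_ℂ =
      ∑ μ ∈ f.support, ((μ.1 : ℂ) * ((‖f μ‖ ^ 2 : ℝ) : ℂ)) := by
    rw [map_sum, sum_inner]
    refine Finset.sum_congr rfl fun i hi => ?_
    rw [inner_sum, Finset.sum_eq_single i]
    · rw [(hf i).2 _ (hf i).1, inner_self_eq_norm_sq_to_K]
      push_cast
      rfl
    · intro j _ hji
      rw [(hf j).2 _ (hf i).1,
        inner_formEigenspace_eq_zero hJ (fun h => hji (Subtype.ext h.symm)) (hf i) (hf j), mul_zero]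
    · exact fun h => absurd hi h
  rw [this, map_sum]
  refine Finset.sum_congr rfl fun i _ => ?_
  rw [← Complex.ofReal_mul]
  exact Complex.ofReal_re _

theorem re_inner_pos_of_mem_formSpan [CompleteSpace K] {J : K →L[ℂ] K} (hJ : IsSelfAdjoint J)
    {E : Submodule ℂ K} {v : K} (hv : v ∈ formSpan J E (0 < ·)) (h0 : v ≠ 0) :
    0 < RCLike.re ⟪v, J v⟫_ℂ := by
  obtain ⟨s, f, hs, hsum⟩ := exists_re_inner_eq_sum hJ hv
  rw [hsum]
  refine Finset.sum_pos' (fun i _ => mul_nonneg i.2.le (sq_nonneg _)) ?_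
  by_contra! hcon
  refine h0 (hs.trans (Finset.sum_eq_zero fun i hi => ?_))
  by_contra hne
  exact absurd (hcon i hi) (not_le.2 (mul_pos i.2 (pow_pos (norm_pos_iff.2 hne) 2)))

theorem re_inner_nonpos_of_mem_formSpan [CompleteSpace K] {J : K →L[ℂ] K} (hJ : IsSelfAdjoint J)
    {E : Submodule ℂ K} {v : K} (hv : v ∈ formSpan J E (· ≤ 0)) :
    RCLike.re ⟪v, J v⟫_ℂ ≤ 0 := by
  obtain ⟨s, f, hs, hsum⟩ := exists_re_inner_eq_sum hJ hv
  rw [hsum]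
  exact Finset.sum_nonpos fun i _ => mul_nonpos_of_nonpos_of_nonneg i.2 (sq_nonneg _)

/-- The eigenspace for zero is the radical of the form on `E`; its vanishing serves throughout as
nondegeneracy. -/
theorem formEigenspace_zero_eq_bot_iff {J : K →L[ℂ] K} {E : Submodule ℂ K} :
    formEigenspace J E 0 = ⊥ ↔ ∀ v ∈ E, (∀ w ∈ E, ⟪w, J v⟫_ℂ = 0) → v = 0 := by
  simp only [Submodule.eq_bot_iff, mem_formEigenspace, Complex.ofReal_zero, zero_mul, and_imp]

theorem inner_apply_symm [CompleteSpace K] {J : K →L[ℂ] K} (hJ : IsSelfAdjoint J) {v w : K} (h : ⟪v, J w⟫_ℂ = 0) :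
    ⟪w, J v⟫_ℂ = 0 := by
  rw [← inner_apply_comm hJ, ← inner_conj_symm, h, map_zero]

theorem formEigenspace_bot (J : K →L[ℂ] K) (μ : ℝ) : formEigenspace J ⊥ μ = ⊥ :=
  le_bot_iff.1 (formEigenspace_le _ _ _)

theorem inner_iSup_right_eq_zero {J : K →L[ℂ] K} {ι : Sort*} {V : ι → Submodule ℂ K} {v : K}
    (h : ∀ i, ∀ w ∈ V i, ⟪v, J w⟫_ℂ = 0) : ∀ w ∈ ⨆ i, V i, ⟪v, J w⟫_ℂ = 0 := by
  intro w hw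
  have hle : (⨆ i, V i) ≤ (((ℂ ∙ v)ᗮ : Submodule ℂ K).comap (J : K →ₗ[ℂ] K)) :=
    iSup_le fun i u hu => Submodule.mem_orthogonal_singleton_iff_inner_right.2 (h i u hu)
  exact Submodule.mem_orthogonal_singleton_iff_inner_right.1 (hle hw)

theorem formEigenspace_zero_sup [CompleteSpace K] {J : K →L[ℂ] K} (hJ : IsSelfAdjoint J) {V W : Submodule ℂ K}
    (hV : formEigenspace J V 0 = ⊥) (hW : formEigenspace J W 0 = ⊥)
    (h : ∀ v ∈ V, ∀ w ∈ W, ⟪v, J w⟫_ℂ = 0) : formEigenspace J (V ⊔ W) 0 = ⊥ := by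
  rw [formEigenspace_zero_eq_bot_iff] at hV hW ⊢
  intro x hx hx0
  obtain ⟨v, hv, w, hw, rfl⟩ := Submodule.mem_sup.1 hx
  have hv0 : v = 0 := hV v hv fun u hu => by
    have := hx0 u (Submodule.mem_sup_left hu)
    rwa [map_add, inner_add_right, h u hu w hw, add_zero] at this
  have hw0 : w = 0 := hW w hw fun u hu => by
    have := hx0 u (Submodule.mem_sup_right hu)
    rwa [map_add, inner_add_right, inner_apply_symm hJ (h v hv u hu), zero_add] at this
  rw [hv0, hw0, add_zero]

/-- The signature of the form `J` on `E`. -/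
noncomputable def formSignature (J : K →L[ℂ] K) (E : Submodule ℂ K) : ℤ :=
  (inertiaPos J E : ℤ) - (inertiaNeg J E : ℤ)

theorem formSignature_bot (J : K →L[ℂ] K) : formSignature J ⊥ = 0 := by
  have h : ∀ s : Set ℝ, (⨆ μ : s, formEigenspace J ⊥ μ) = ⊥ := fun s =>
    iSup_eq_bot.2 fun _ => formEigenspace_bot J _
  have h1 : inertiaPos J ⊥ = 0 := by
    rw [inertiaPos]; exact (congrArg (fun S : Submodule ℂ K => Module.finrank ℂ S)
      (h {μ | 0 < μ})).trans (finrank_bot ℂ K)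
  have h2 : inertiaNeg J ⊥ = 0 := by
    rw [inertiaNeg]; exact (congrArg (fun S : Submodule ℂ K => Module.finrank ℂ S)
      (h {μ | μ < 0})).trans (finrank_bot ℂ K)
  rw [formSignature, h1, h2, sub_self]

theorem exists_finrank_eq_inertiaPos [CompleteSpace K] {J : K →L[ℂ] K} (hJ : IsSelfAdjoint J) (E : Submodule ℂ K) :
    ∃ X ≤ E, Module.finrank ℂ X = inertiaPos J E ∧
      ∀ v ∈ X, v ≠ 0 → 0 < RCLike.re ⟪v, J v⟫_ℂ :=
  ⟨formSpan J E (0 < ·), formSpan_le _ _ _, rfl, fun _ => re_inner_pos_of_mem_formSpan hJ⟩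

theorem exists_finrank_eq_inertiaNeg [CompleteSpace K] {J : K →L[ℂ] K} (hJ : IsSelfAdjoint J) (E : Submodule ℂ K) :
    ∃ X ≤ E, Module.finrank ℂ X = inertiaNeg J E ∧
      ∀ v ∈ X, v ≠ 0 → RCLike.re ⟪v, J v⟫_ℂ < 0 := by
  obtain ⟨X, hXE, hX, hpos⟩ := exists_finrank_eq_inertiaPos hJ.neg E
  refine ⟨X, hXE, hX.trans (inertiaNeg_eq_inertiaPos_neg J E).symm, fun v hv h0 => ?_⟩
  simpa using hpos v hv h0

theorem re_inner_self_pos {v : K} (h : v ≠ 0) : 0 < RCLike.re ⟪v, v⟫_ℂ := by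
  rw [inner_self_eq_norm_sq]
  exact pow_pos (norm_pos_iff.2 h) 2

variable [FiniteDimensional ℂ K]

theorem finrank_add_finrank_le {X Y E : Submodule ℂ K} (hX : X ≤ E) (hY : Y ≤ E)
    (h : ∀ v ∈ X, v ∈ Y → v = 0) : Module.finrank ℂ X + Module.finrank ℂ Y ≤ Module.finrank ℂ E := by
  rw [← Submodule.finrank_sup_add_finrank_inf_eq, (Submodule.disjoint_def.2 h).eq_bot, finrank_bot,
    add_zero]
  exact Submodule.finrank_mono (sup_le hX hY)


/-- The spectral theorem for the form on `E`. -/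
theorem iSup_formEigenspace [CompleteSpace K] {J : K →L[ℂ] K} (hJ : IsSelfAdjoint J)
    (E : Submodule ℂ K) : ⨆ μ : ℝ, formEigenspace J E μ = E := by
  refine le_antisymm (iSup_le fun _ => formEigenspace_le _ _ _) ?_
  -- The compression of `J` to `E` is symmetric, and its eigenspaces are those of the form.
  set C : E →ₗ[ℂ] E := (E.orthogonalProjectionOnto : K →ₗ[ℂ] E) ∘ₗ (J : K →ₗ[ℂ] K) ∘ₗ E.subtype with hC
  have hCinner : ∀ v w : E, ⟪w, C v⟫_ℂ = ⟪(w : K), J v⟫_ℂ := fun v w =>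
    E.inner_orthogonalProjectionOnto_eq_of_mem_left w (J v)
  have hsymm : C.IsSymmetric := by
    intro v w
    rw [hCinner, ← inner_conj_symm, hCinner, inner_conj_symm, inner_apply_comm hJ]
  have htop : ⨆ μ : ℂ, Module.End.eigenspace C μ = ⊤ := by
    have := hsymm.orthogonalComplement_iSup_eigenspaces_eq_bot
    rwa [Submodule.orthogonal_eq_bot_iff] at this
  have hmap := congrArg (Submodule.map E.subtype) htop
  rw [Submodule.map_iSup, Submodule.map_subtype_top] at hmap
  conv_lhs => rw [← hmap]
  refine iSup_le fun μ => ?_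
  by_cases hμ : Module.End.HasEigenvalue C μ
  · have hreal : ((RCLike.re μ : ℝ) : ℂ) = μ :=
      RCLike.conj_eq_iff_re.1 (hsymm.conj_eigenvalue_eq_self hμ)
    refine le_trans ?_ (le_iSup _ (RCLike.re μ : ℝ))
    rintro _ ⟨v, hv, rfl⟩
    refine ⟨v.2, fun w hw => ?_⟩
    have hv' : C v = μ • v := Module.End.mem_eigenspace_iff.1 hv
    have := hCinner v ⟨w, hw⟩
    rw [hv', inner_smul_right] at this
    rw [hreal]
    exact this.symm
  · have : Module.End.eigenspace C μ = ⊥ := by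
      by_contra h
      exact hμ h
    rw [this, Submodule.map_bot]
    exact bot_le

variable [CompleteSpace K] {J : K →L[ℂ] K}

/-- The positive inertia bounds the dimension of every positive definite subspace. -/
theorem finrank_le_inertiaPos (hJ : IsSelfAdjoint J) {E X : Submodule ℂ K} (hXE : X ≤ E)
    (hX : ∀ v ∈ X, v ≠ 0 → 0 < RCLike.re ⟪v, J v⟫_ℂ) :
    Module.finrank ℂ X ≤ inertiaPos J E := by
  -- A positive definite subspace avoids the span of the nonpositive eigenspaces, whose codimension
  -- in `E` is at most `inertiaPos J E`.
  have hdisj : Disjoint X (formSpan J E (· ≤ 0)) := by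
    rw [Submodule.disjoint_def]
    intro v hv hv'
    by_contra h0
    exact absurd (re_inner_nonpos_of_mem_formSpan hJ hv') (not_le.2 (hX v hv h0))
  have h1 : Module.finrank ℂ X + Module.finrank ℂ (formSpan J E (· ≤ 0)) ≤ Module.finrank ℂ E := by
    rw [← Submodule.finrank_sup_add_finrank_inf_eq, hdisj.eq_bot, finrank_bot, add_zero]
    exact Submodule.finrank_mono (sup_le hXE (formSpan_le _ _ _))
  have h2 : E ≤ formSpan J E (0 < ·) ⊔ formSpan J E (· ≤ 0) := by
    conv_lhs => rw [← iSup_formEigenspace hJ E]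
    refine iSup_le fun μ => ?_
    rcases lt_or_ge 0 μ with h | h
    · exact le_sup_of_le_left
        (le_iSup (fun μ : {μ : ℝ // 0 < μ} => formEigenspace J E μ) ⟨μ, h⟩)
    · exact le_sup_of_le_right
        (le_iSup (fun μ : {μ : ℝ // μ ≤ 0} => formEigenspace J E μ) ⟨μ, h⟩)
  have h3 := (Submodule.finrank_mono h2).trans
    (Submodule.finrank_add_le_finrank_add_finrank _ _)
  have h4 : inertiaPos J E = Module.finrank ℂ (formSpan J E (0 < ·)) := rfl
  omega

theorem finrank_le_inertiaNeg (hJ : IsSelfAdjoint J) {E X : Submodule ℂ K} (hXE : X ≤ E)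
    (hX : ∀ v ∈ X, v ≠ 0 → RCLike.re ⟪v, J v⟫_ℂ < 0) :
    Module.finrank ℂ X ≤ inertiaNeg J E := by
  rw [inertiaNeg_eq_inertiaPos_neg]
  refine finrank_le_inertiaPos hJ.neg hXE fun v hv h0 => ?_
  simpa using hX v hv h0

theorem inertia_add_le (hJ : IsSelfAdjoint J) (E : Submodule ℂ K) :
    inertiaPos J E + inertiaNeg J E ≤ Module.finrank ℂ E := by
  obtain ⟨X, hXE, hX, hpos⟩ := exists_finrank_eq_inertiaPos hJ E
  obtain ⟨Y, hYE, hY, hneg⟩ := exists_finrank_eq_inertiaNeg hJ E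
  rw [← hX, ← hY]
  refine finrank_add_finrank_le hXE hYE fun v h1 h2 => ?_
  by_contra h0
  exact lt_asymm (hpos v h1 h0) (hneg v h2 h0)

/-- The inertia indices of a nondegenerate form add up to the dimension. -/
theorem inertia_add_eq (hJ : IsSelfAdjoint J) {E : Submodule ℂ K}
    (hE : formEigenspace J E 0 = ⊥) :
    inertiaPos J E + inertiaNeg J E = Module.finrank ℂ E := by
  refine le_antisymm (inertia_add_le hJ E) ?_
  have h2 : E ≤ formSpan J E (0 < ·) ⊔ formSpan J E (· < 0) := by
    conv_lhs => rw [← iSup_formEigenspace hJ E]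
    refine iSup_le fun μ => ?_
    rcases lt_trichotomy 0 μ with h | h | h
    · exact le_sup_of_le_left
        (le_iSup (fun μ : {μ : ℝ // 0 < μ} => formEigenspace J E μ) ⟨μ, h⟩)
    · rw [← h, hE]
      exact bot_le
    · exact le_sup_of_le_right
        (le_iSup (fun μ : {μ : ℝ // μ < 0} => formEigenspace J E μ) ⟨μ, h⟩)
  exact (Submodule.finrank_mono h2).trans (Submodule.finrank_add_le_finrank_add_finrank _ _)

/-- Maximal positive subspaces of `V` and `W` are `J`-orthogonal, so they are independent and their
sum is again positive definite. -/
theorem inertiaPos_add_le_sup (hJ : IsSelfAdjoint J) {V W : Submodule ℂ K}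
    (h : ∀ v ∈ V, ∀ w ∈ W, ⟪v, J w⟫_ℂ = 0) :
    inertiaPos J V + inertiaPos J W ≤ inertiaPos J (V ⊔ W) := by
  obtain ⟨X, hXV, hX, hpX⟩ := exists_finrank_eq_inertiaPos hJ V
  obtain ⟨Y, hYW, hY, hpY⟩ := exists_finrank_eq_inertiaPos hJ W
  rw [← hX, ← hY]
  refine (finrank_add_finrank_le (le_sup_left : X ≤ X ⊔ Y) le_sup_right fun v h1 h2 => ?_).trans
    (finrank_le_inertiaPos hJ (sup_le_sup hXV hYW) ?_)
  · by_contra h0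
    have := hpX v h1 h0
    rw [h v (hXV h1) v (hYW h2), map_zero] at this
    exact lt_irrefl _ this
  · intro x hx h0
    obtain ⟨v, hv, w, hw, rfl⟩ := Submodule.mem_sup.1 hx
    have e : ⟪v + w, J (v + w)⟫_ℂ = ⟪v, J v⟫_ℂ + ⟪w, J w⟫_ℂ := by
      rw [map_add, inner_add_left, inner_add_right, inner_add_right,
        h v (hXV hv) w (hYW hw), inner_apply_symm hJ (h v (hXV hv) w (hYW hw)), add_zero, zero_add]
    rw [e, map_add]
    by_cases hv0 : v = 0
    · have hw0 : w ≠ 0 := fun hw0 => h0 (by rw [hv0, hw0, add_zero])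
      simpa [hv0] using hpY w hw hw0
    · by_cases hw0 : w = 0
      · simpa [hw0] using hpX v hv hv0
      · exact add_pos (hpX v hv hv0) (hpY w hw hw0)

theorem inertiaNeg_add_le_sup (hJ : IsSelfAdjoint J) {V W : Submodule ℂ K}
    (h : ∀ v ∈ V, ∀ w ∈ W, ⟪v, J w⟫_ℂ = 0) :
    inertiaNeg J V + inertiaNeg J W ≤ inertiaNeg J (V ⊔ W) := by
  simp only [inertiaNeg_eq_inertiaPos_neg]
  exact inertiaPos_add_le_sup hJ.neg fun v hv w hw => by simp [h v hv w hw]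

/-- The signature is additive on orthogonal sums of nondegenerate subspaces. -/
theorem formSignature_sup (hJ : IsSelfAdjoint J) {V W : Submodule ℂ K}
    (hV : formEigenspace J V 0 = ⊥) (hW : formEigenspace J W 0 = ⊥)
    (h : ∀ v ∈ V, ∀ w ∈ W, ⟪v, J w⟫_ℂ = 0) :
    formSignature J (V ⊔ W) = formSignature J V + formSignature J W := by
  have h1 := inertia_add_eq hJ hV
  have h2 := inertia_add_eq hJ hW
  have h3 := inertia_add_le hJ (V ⊔ W)
  -- The inertias of `V ⊔ W` dominate the sums, while their total is at most `dim V + dim W`, which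
  -- those sums already exhaust; so equality holds in each.
  have h4 := Submodule.finrank_add_le_finrank_add_finrank V W
  have h5 := inertiaPos_add_le_sup hJ h
  have h6 := inertiaNeg_add_le_sup hJ h
  unfold formSignature
  omega

theorem formSignature_finset_sup (hJ : IsSelfAdjoint J) {ι : Type*} (s : Finset ι)
    (V : ι → Submodule ℂ K) (hV : ∀ i ∈ s, formEigenspace J (V i) 0 = ⊥)
    (h : ∀ i ∈ s, ∀ j ∈ s, i ≠ j → ∀ v ∈ V i, ∀ w ∈ V j, ⟪v, J w⟫_ℂ = 0) :
    formEigenspace J (s.sup V) 0 = ⊥ ∧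
      formSignature J (s.sup V) = ∑ i ∈ s, formSignature J (V i) := by
  classical
  induction s using Finset.induction_on with
  | empty => exact ⟨formEigenspace_bot J 0, formSignature_bot J⟩
  | insert a s ha ih =>
    obtain ⟨ih1, ih2⟩ := ih (fun i hi => hV i (Finset.mem_insert_of_mem hi))
      fun i hi j hj => h i (Finset.mem_insert_of_mem hi) j (Finset.mem_insert_of_mem hj)
    have ha' := hV a (Finset.mem_insert_self a s)
    have horth : ∀ v ∈ V a, ∀ w ∈ s.sup V, ⟪v, J w⟫_ℂ = 0 := by
      intro v hv w hw
      rw [Finset.sup_eq_iSup] at hw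
      refine inner_iSup_right_eq_zero (fun j => inner_iSup_right_eq_zero fun hj => ?_) w hw
      exact h a (Finset.mem_insert_self a s) j (Finset.mem_insert_of_mem hj)
        (fun e => ha (e ▸ hj)) v hv
    rw [Finset.sup_insert, Finset.sum_insert ha]
    exact ⟨formEigenspace_zero_sup hJ ha' ih1 horth,
      by rw [formSignature_sup hJ ha' ih1 horth, ih2]⟩

/-- A nondegenerate sum of two isotropic subspaces has signature zero. -/
theorem formSignature_sup_of_isotropic (hJ : IsSelfAdjoint J) {U L : Submodule ℂ K}
    (hU : ∀ v ∈ U, ∀ w ∈ U, ⟪v, J w⟫_ℂ = 0) (hL : ∀ v ∈ L, ∀ w ∈ L, ⟪v, J w⟫_ℂ = 0)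
    (hnd : formEigenspace J (U ⊔ L) 0 = ⊥) : formSignature J (U ⊔ L) = 0 := by
  have hadd := inertia_add_eq hJ hnd
  have hle := Submodule.finrank_add_le_finrank_add_finrank U L
  have hUL : Module.finrank ℂ U + Module.finrank ℂ L ≤ Module.finrank ℂ (U ⊔ L : Submodule ℂ K) := by
    -- A vector common to `U` and `L` is orthogonal to both, so it lies in the radical.
    refine finrank_add_finrank_le le_sup_left le_sup_right fun x hxU hxL => ?_
    refine formEigenspace_zero_eq_bot_iff.1 hnd x (Submodule.mem_sup_left hxU) fun y hy => ?_
    obtain ⟨u, hu, l, hl, rfl⟩ := Submodule.mem_sup.1 hy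
    rw [inner_add_left, hU u hu x hxU, hL l hl x hxL, add_zero]
  obtain ⟨X, hXE, hX, hpX⟩ := exists_finrank_eq_inertiaPos hJ (U ⊔ L)
  obtain ⟨Y, hYE, hY, hnY⟩ := exists_finrank_eq_inertiaNeg hJ (U ⊔ L)
  -- A definite subspace meets an isotropic one only in zero. Hence each inertia index is at most
  -- `dim L` and at most `dim U`; as the two indices add up to `dim U + dim L`, they coincide.
  have key : ∀ Z : Submodule ℂ K, Z ≤ U ⊔ L → (∀ v ∈ Z, v ≠ 0 → RCLike.re ⟪v, J v⟫_ℂ ≠ 0) →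
      ∀ M ≤ U ⊔ L, (∀ v ∈ M, ∀ w ∈ M, ⟪v, J w⟫_ℂ = 0) →
      Module.finrank ℂ Z + Module.finrank ℂ M ≤ Module.finrank ℂ (U ⊔ L : Submodule ℂ K) := by
    intro Z hZ hdef M hM hiso
    refine finrank_add_finrank_le hZ hM fun v hv hv' => ?_
    by_contra h0
    exact hdef v hv h0 (by rw [hiso v hv' v hv', map_zero])
  have a1 := key X hXE (fun v hv h0 => (hpX v hv h0).ne') U le_sup_left hU
  have a2 := key X hXE (fun v hv h0 => (hpX v hv h0).ne') L le_sup_right hL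
  have a3 := key Y hYE (fun v hv h0 => (hnY v hv h0).ne) U le_sup_left hU
  have a4 := key Y hYE (fun v hv h0 => (hnY v hv h0).ne) L le_sup_right hL
  unfold formSignature
  omega

/-- The eigenspaces of `J` are definite and span `K`, so the dimension count forces both inertia
bounds to be equalities. -/
theorem formSignature_top (hJ : IsFundamentalSymmetry J) :
    formSignature J ⊤ =
      (Module.finrank ℂ (plusSpace J) : ℤ) - (Module.finrank ℂ (minusSpace J) : ℤ) := by
  have h1 : Module.finrank ℂ (plusSpace J) ≤ inertiaPos J ⊤ :=
    finrank_le_inertiaPos hJ.1 le_top fun v hv h0 => by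
      rw [mem_plusSpace.1 hv]
      exact re_inner_self_pos h0
  have h2 : Module.finrank ℂ (minusSpace J) ≤ inertiaNeg J ⊤ :=
    finrank_le_inertiaNeg hJ.1 le_top fun v hv h0 => by
      rw [mem_minusSpace.1 hv, inner_neg_right, map_neg, neg_lt_zero]
      exact re_inner_self_pos h0
  have h3 := inertia_add_le hJ.1 (⊤ : Submodule ℂ K)
  have h4 := Submodule.finrank_add_le_finrank_add_finrank (plusSpace J) (minusSpace J)
  rw [hJ.sup_eq_top] at h4
  unfold formSignature
  omega

end Inertia

/-! ### Riesz projections in finite dimension. -/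

section Riesz

variable {K : Type*} [NormedAddCommGroup K] [InnerProductSpace ℂ K]

theorem isUnit_iff_injective_of_finiteDimensional [FiniteDimensional ℂ K] [CompleteSpace K]
    {A : K →L[ℂ] K} : IsUnit A ↔ Function.Injective A := by
  rw [ContinuousLinearMap.isUnit_iff_bijective]
  exact ⟨fun h => h.1, fun h => ⟨h, (LinearMap.injective_iff_surjective (f := (A : K →ₗ[ℂ] K))).1 h⟩⟩

theorem mem_resolventSet_of_not_hasEigenvalue [FiniteDimensional ℂ K] [CompleteSpace K]
    {A : K →L[ℂ] K} {z : ℂ} (hz : ¬ Module.End.HasEigenvalue (A : Module.End ℂ K) z) :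
    z ∈ resolventSet ℂ A := by
  rw [spectrum.mem_resolventSet_iff, isUnit_iff_injective_of_finiteDimensional,
    injective_iff_map_eq_zero]
  intro v hv
  by_contra h0
  refine hz (Module.End.hasEigenvalue_of_hasEigenvector
    (⟨Module.End.mem_eigenspace_iff.2 ?_, h0⟩ : Module.End.HasEigenvector (A : Module.End ℂ K) z v))
  rw [Algebra.algebraMap_eq_smul_one] at hv
  exact (sub_eq_zero.1 hv).symm

theorem resolvent_apply_eq [CompleteSpace K] {A : K →L[ℂ] K} {z : ℂ} (hz : z ∈ resolventSet ℂ A)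
    {v w : K} (h : z • w - A w = v) : resolvent A z v = w := by
  have h1 : resolvent A z * (algebraMap ℂ (K →L[ℂ] K) z - A) = 1 := Ring.inverse_mul_cancel _ hz
  have h2 := congrArg (fun f : K →L[ℂ] K => f w) h1
  rw [← h]
  simpa [Algebra.algebraMap_eq_smul_one] using h2

/-- The resolvent on a generalized eigenvector is a Laurent polynomial. -/
theorem resolvent_apply_of_pow_eq_zero [CompleteSpace K] {A : K →L[ℂ] K} {z a : ℂ}
    (hz : z ∈ resolventSet ℂ A) (hza : z ≠ a) {k : ℕ} {v : K}
    (hv : ((A - a • (1 : K →L[ℂ] K)) ^ k) v = 0) :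
    resolvent A z v = ∑ j ∈ Finset.range k,
      (z - a) ^ (-(j + 1 : ℤ)) • ((A - a • (1 : K →L[ℂ] K)) ^ j) v := by
  set N := A - a • (1 : K →L[ℂ] K) with hN
  have hu : z - a ≠ 0 := sub_ne_zero.2 hza
  refine resolvent_apply_eq hz ?_
  have hzA : ∀ w, z • w - A w = (z - a) • w - N w := by
    intro w
    simp only [hN, sub_apply, smul_apply, one_apply_eq_self, sub_smul]
    abel
  rw [hzA, map_sum, Finset.smul_sum, ← Finset.sum_sub_distrib]
  -- Applying `z - A = (z - a) - N` makes the sum telescope, leaving `v` since `N ^ k` kills `v`.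
  have hterm : ∀ j ∈ Finset.range k,
      (z - a) • (z - a) ^ (-(j + 1 : ℤ)) • (N ^ j) v - N ((z - a) ^ (-(j + 1 : ℤ)) • (N ^ j) v) =
        (z - a) ^ (-(j : ℤ)) • (N ^ j) v - (z - a) ^ (-((j + 1 : ℕ) : ℤ)) • (N ^ (j + 1)) v := by
    intro j _
    rw [smul_smul, ← zpow_one_add₀ hu, map_smul, pow_succ']
    congr 2
    congr 1
    ring
  rw [Finset.sum_congr rfl hterm, Finset.sum_range_sub']
  simp [hv]

theorem circleIntegral_sub_inv_of_notMem_closedBall {c a : ℂ} {r : ℝ} (hr : 0 < r)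
    (ha : a ∉ Metric.closedBall c r) : (∮ z in C(c, r), (z - a)⁻¹) = 0 := by
  have hd : ∀ z ∈ Metric.closedBall c r, DifferentiableAt ℂ (fun z : ℂ => (z - a)⁻¹) z := by
    intro z hz
    exact (differentiableAt_id.sub_const a).inv (sub_ne_zero.2 fun h => ha (h ▸ hz))
  exact Complex.circleIntegral_eq_zero_of_differentiable_on_off_countable hr.le
    Set.countable_empty (fun z hz => (hd z hz).continuousAt.continuousWithinAt)
    fun z hz => hd z (Metric.ball_subset_closedBall hz.1)

/-- The contour integral of the resolvent on a generalized eigenvector. -/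
theorem circleIntegral_resolvent_apply [CompleteSpace K] {A : K →L[ℂ] K} {c a : ℂ} {r : ℝ}
    (hr : 0 < r) (hres : ∀ z ∈ Metric.sphere c r, z ∈ resolventSet ℂ A)
    (ha : a = c ∨ a ∉ Metric.closedBall c r) {k : ℕ} {v : K}
    (hv : ((A - a • (1 : K →L[ℂ] K)) ^ k) v = 0) :
    (∮ z in C(c, r), resolvent A z) v =
      if a = c then (2 * (Real.pi : ℂ) * Complex.I) • v else 0 := by
  have hcont : ContinuousOn (resolvent A) (Metric.sphere c r) := fun z hz =>
    (spectrum.hasDerivAt_resolvent_const_left (hres z hz)).continuousAt.continuousWithinAt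
  have hint : CircleIntegrable (resolvent A) c r := hcont.circleIntegrable hr.le
  have happ : (∮ z in C(c, r), resolvent A z) v = ∮ z in C(c, r), resolvent A z v := by
    rw [circleIntegral, ContinuousLinearMap.intervalIntegral_apply hint.out]
    rfl
  have hasph : a ∉ Metric.sphere c r := by
    rcases ha with rfl | ha
    · simp [hr.ne]
    · exact fun h => ha (Metric.sphere_subset_closedBall h)
  have hne : ∀ z ∈ Metric.sphere c r, z ≠ a := fun z hz h => hasph (h ▸ hz)
  rw [happ, circleIntegral.integral_congr hr.le
    (fun z hz => resolvent_apply_of_pow_eq_zero (hres z hz) (hne z hz) hv)]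
  rw [circleIntegral.integral_fun_sum]
  swap
  · intro j _
    refine ContinuousOn.circleIntegrable hr.le ?_
    refine ContinuousOn.smul (fun z hz => ?_) continuousOn_const
    exact ((continuousAt_id.sub continuousAt_const).zpow₀ _
      (Or.inl (sub_ne_zero.2 (hne z hz)))).continuousWithinAt
  -- Only the residue term, the power `-1` at `j = 0`, can contribute; the other powers have
  -- primitives.
  have hj : ∀ j ∈ Finset.range k, j ≠ 0 →
      (∮ z in C(c, r), (z - a) ^ (-(j + 1 : ℤ)) • ((A - a • (1 : K →L[ℂ] K)) ^ j) v) = 0 := by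
    intro j _ hj0
    rw [circleIntegral.integral_smul_const, circleIntegral.integral_sub_zpow_of_ne (by omega),
      zero_smul]
  rcases Nat.eq_zero_or_pos k with rfl | hk
  · have : v = 0 := by simpa using hv
    simp [this]
  rw [Finset.sum_eq_single 0 hj (fun h => absurd (Finset.mem_range.2 hk) h),
    circleIntegral.integral_smul_const]
  simp only [Nat.cast_zero, zero_add, pow_zero, one_apply_eq_self, zpow_neg, zpow_one]
  split_ifs with h
  · rw [h, circleIntegral.integral_sub_center_inv c hr.ne']
  · rw [circleIntegral_sub_inv_of_notMem_closedBall hr (ha.resolve_left h), zero_smul]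

theorem mem_maxGenEigenspace_iff_pow {A : K →L[ℂ] K} {a : ℂ} {v : K} :
    v ∈ Module.End.maxGenEigenspace (A : Module.End ℂ K) a ↔
      ∃ k : ℕ, ((A - a • (1 : K →L[ℂ] K)) ^ k) v = 0 := by
  rw [Module.End.mem_maxGenEigenspace]
  refine exists_congr fun k => ?_
  have : ((A : Module.End ℂ K) - a • 1) ^ k =
      (((A - a • (1 : K →L[ℂ] K)) ^ k : K →L[ℂ] K) : Module.End ℂ K) :=
    (map_pow (ContinuousLinearMap.toLinearMapRingHom : (K →L[ℂ] K) →+* Module.End ℂ K)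
      (A - a • (1 : K →L[ℂ] K)) k).symm
  rw [this]
  rfl

theorem maxGenEigenspace_eq_bot_of_not_hasEigenvalue {A : Module.End ℂ K} {a : ℂ}
    (h : ¬ A.HasEigenvalue a) : A.maxGenEigenspace a = ⊥ := by
  rw [Submodule.eq_bot_iff]
  intro v hv
  obtain ⟨k, hk⟩ := (Module.End.mem_maxGenEigenspace A a v).1 hv
  have hinj : Function.Injective (A - a • (1 : Module.End ℂ K)) := by
    rw [injective_iff_map_eq_zero]
    intro w hw
    by_contra h0
    exact h (Module.End.hasEigenvalue_of_hasEigenvector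
      (⟨Module.End.mem_eigenspace_iff.2 (sub_eq_zero.1 hw), h0⟩ : A.HasEigenvector a w))
  have hpow : Function.Injective ((A - a • (1 : Module.End ℂ K)) ^ k) := by
    rw [Module.End.coe_pow]
    exact hinj.iterate k
  exact hpow (hk.trans (map_zero _).symm)

variable [FiniteDimensional ℂ K]

theorem ext_on_maxGenEigenspace (A : K →L[ℂ] K) {P Q : K →L[ℂ] K}
    (h : ∀ a : ℂ, ∀ v ∈ Module.End.maxGenEigenspace (A : Module.End ℂ K) a, P v = Q v) : P = Q := by
  ext v
  have hle : (⨆ a : ℂ, Module.End.maxGenEigenspace (A : Module.End ℂ K) a) ≤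
      LinearMap.eqLocus (P : K →ₗ[ℂ] K) (Q : K →ₗ[ℂ] K) := iSup_le fun a v hv => h a v hv
  rw [Module.End.iSup_maxGenEigenspace_eq_top] at hle
  exact hle (Submodule.mem_top (x := v))

variable [CompleteSpace K]

/-- There are finitely many eigenvalues, so small discs around `c` contain none except possibly `c`.
The integral therefore stops depending on the radius, which identifies the limit in
`rieszProjection`. -/
theorem eventually_rieszIntegral_apply (A : K →L[ℂ] K) (c : ℂ) :
    ∀ᶠ r : ℝ in 𝓝[>] 0, ∀ a : ℂ, ∀ v ∈ Module.End.maxGenEigenspace (A : Module.End ℂ K) a,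
      ((2 * (Real.pi : ℂ) * Complex.I)⁻¹ • ∮ z in C(c, r), resolvent A z) v =
        if a = c then v else 0 := by
  set S : Set ℂ := {z | Module.End.HasEigenvalue (A : Module.End ℂ K) z} \ {c} with hS
  have hfin : S.Finite := (Module.End.finite_hasEigenvalue (A : Module.End ℂ K)).subset
    Set.sdiff_subset
  obtain ⟨ε, hε, hball⟩ := Metric.nhds_basis_closedBall.mem_iff.1
    (hfin.isClosed.isOpen_compl.mem_nhds (show c ∈ Sᶜ from fun h => h.2 rfl))
  filter_upwards [Ioc_mem_nhdsGT hε] with r hr a v hv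
  have hout : ∀ z ∈ Metric.closedBall c r, z ≠ c →
      ¬ Module.End.HasEigenvalue (A : Module.End ℂ K) z := fun z hz hzc he =>
    hball (Metric.closedBall_subset_closedBall hr.2 hz) ⟨he, hzc⟩
  by_cases hv0 : v = 0
  · simp [hv0]
  have hea : Module.End.HasEigenvalue (A : Module.End ℂ K) a := by
    by_contra hne
    have hbot := maxGenEigenspace_eq_bot_of_not_hasEigenvalue hne
    rw [hbot] at hv
    exact hv0 ((Submodule.mem_bot ℂ).1 hv)
  obtain ⟨k, hk⟩ := mem_maxGenEigenspace_iff_pow.1 hv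
  have ha : a = c ∨ a ∉ Metric.closedBall c r := by
    by_contra! h
    exact hout a h.2 h.1 hea
  rw [smul_apply, circleIntegral_resolvent_apply hr.1 (fun z hz =>
    mem_resolventSet_of_not_hasEigenvalue (hout z (Metric.sphere_subset_closedBall hz)
      (fun h => by rw [h] at hz; simp [hr.1.ne] at hz))) ha hk]
  split_ifs with h
  · rw [smul_smul, inv_mul_cancel₀ Complex.two_pi_I_ne_zero, one_smul]
  · rw [smul_zero]

theorem rieszProjection_apply (A : K →L[ℂ] K) (c a : ℂ) {v : K}
    (hv : v ∈ Module.End.maxGenEigenspace (A : Module.End ℂ K) a) :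
    rieszProjection A c v = if a = c then v else 0 := by
  have hev := eventually_rieszIntegral_apply A c
  obtain ⟨r, hr⟩ := hev.exists
  have hlim : rieszProjection A c =
      (2 * (Real.pi : ℂ) * Complex.I)⁻¹ • ∮ z in C(c, r), resolvent A z := by
    refine Filter.Tendsto.limUnder_eq ?_
    refine tendsto_const_nhds.congr' ?_
    filter_upwards [hev] with s hs
    exact ext_on_maxGenEigenspace A fun a v hv => (hr a v hv).trans (hs a v hv).symm
  rw [hlim, hr a v hv]

/-- In finite dimension, the range of the Riesz projection is the generalized eigenspace. -/
theorem spectralSpace_eq_maxGenEigenspace (A : K →L[ℂ] K) (c : ℂ) :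
    spectralSpace A c = Module.End.maxGenEigenspace (A : Module.End ℂ K) c := by
  refine le_antisymm ?_ fun v hv => ⟨v, (rieszProjection_apply A c c hv).trans (if_pos rfl)⟩
  have hle : (⨆ a : ℂ, Module.End.maxGenEigenspace (A : Module.End ℂ K) a) ≤
      (Module.End.maxGenEigenspace (A : Module.End ℂ K) c).comap
        (rieszProjection A c : K →ₗ[ℂ] K) := by
    refine iSup_le fun a v hv => ?_
    have := rieszProjection_apply A c a hv
    rw [Submodule.mem_comap, ContinuousLinearMap.coe_coe, this]
    split_ifs with h
    · exact h ▸ hv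
    · exact zero_mem _
  rw [Module.End.iSup_maxGenEigenspace_eq_top] at hle
  rintro _ ⟨v, rfl⟩
  exact hle (Submodule.mem_top (x := v))

end Riesz

/-! ### The global signature in finite dimension. -/

section Signature

variable {K : Type*} [NormedAddCommGroup K] [InnerProductSpace ℂ K] [CompleteSpace K]

theorem IsJHermitian.inner_apply {J H : K →L[ℂ] K} (hH : IsJHermitian J H) (v w : K) :
    ⟪H w, J v⟫_ℂ = ⟪w, J (H v)⟫_ℂ := by
  rw [← ContinuousLinearMap.adjoint_inner_right]
  exact congrArg (fun f : K →L[ℂ] K => ⟪w, f v⟫_ℂ) hH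

/-- Generalized eigenspaces are orthogonal for the form unless the eigenvalues are conjugate. -/
theorem inner_maxGenEigenspace_eq_zero {J H : K →L[ℂ] K} (hH : IsJHermitian J H) {a b : ℂ}
    (hab : a ≠ starRingEnd ℂ b) {v w : K}
    (hv : v ∈ Module.End.maxGenEigenspace (H : Module.End ℂ K) a)
    (hw : w ∈ Module.End.maxGenEigenspace (H : Module.End ℂ K) b) : ⟪w, J v⟫_ℂ = 0 := by
  obtain ⟨k, hk⟩ := mem_maxGenEigenspace_iff_pow.1 hv
  obtain ⟨m, hm⟩ := mem_maxGenEigenspace_iff_pow.1 hw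
  clear hv hw
  -- Double induction on the nilpotency orders: lowering either order gives a vanishing pairing, and
  -- the two combine to `(a - conj b) ⟪w, J v⟫ = 0`.
  induction k generalizing v w m with
  | zero =>
    have : v = 0 := by simpa using hk
    simp [this]
  | succ k ihk =>
    induction m generalizing w with
    | zero =>
      have : w = 0 := by simpa using hm
      simp [this]
    | succ m ihm =>
      have h1 : ⟪w, J ((H - a • (1 : K →L[ℂ] K)) v)⟫_ℂ = 0 :=
        ihk (by rwa [pow_succ] at hk) (m + 1) hm
      have h2 : ⟪(H - b • (1 : K →L[ℂ] K)) w, J v⟫_ℂ = 0 := ihm (by rwa [pow_succ] at hm)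
      have h3 := hH.inner_apply v w
      simp only [sub_apply, smul_apply, one_apply_eq_self, map_sub, map_smul, inner_sub_left,
        inner_sub_right, inner_smul_left, inner_smul_right] at h1 h2
      have h4 : (a - starRingEnd ℂ b) * ⟪w, J v⟫_ℂ = 0 := by linear_combination h2 - h1 - h3
      exact (mul_eq_zero.1 h4).resolve_left (sub_ne_zero.2 hab)

theorem inner_iSup_eq_zero {J : K →L[ℂ] K} (hJ : IsSelfAdjoint J) {ι κ : Sort*}
    {V : ι → Submodule ℂ K} {W : κ → Submodule ℂ K}
    (h : ∀ i j, ∀ v ∈ V i, ∀ w ∈ W j, ⟪v, J w⟫_ℂ = 0) :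
    ∀ v ∈ ⨆ i, V i, ∀ w ∈ ⨆ j, W j, ⟪v, J w⟫_ℂ = 0 := fun v hv =>
  inner_iSup_right_eq_zero fun j w hw => inner_apply_symm hJ <|
    inner_iSup_right_eq_zero (fun i u hu => inner_apply_symm hJ (h i j u hu w hw)) v hv

/-- If `v` is in the radical of `V`, then `J v` is orthogonal to `V` and to `W`, hence zero, and `J`
is injective. -/
theorem formEigenspace_zero_of_sup_eq_top {J : K →L[ℂ] K} (hJ : IsFundamentalSymmetry J)
    {V W : Submodule ℂ K} (htop : V ⊔ W = ⊤) (h : ∀ v ∈ V, ∀ w ∈ W, ⟪v, J w⟫_ℂ = 0) :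
    formEigenspace J V 0 = ⊥ := by
  rw [formEigenspace_zero_eq_bot_iff]
  intro v hv hv0
  have hJv : J v = 0 := by
    rw [← inner_self_eq_zero (𝕜 := ℂ)]
    have hmem : J v ∈ V ⊔ W := htop ▸ Submodule.mem_top
    obtain ⟨x, hx, y, hy, hxy⟩ := Submodule.mem_sup.1 hmem
    nth_rw 1 [← hxy]
    rw [inner_add_left, hv0 x hx, inner_apply_symm hJ.1 (h v hv y hy), add_zero]
  rw [← hJ.apply_apply v, hJv, map_zero]

/-- In finite dimension, the global Krein signature is the signature of the form. -/
theorem globalSignature_eq [FiniteDimensional ℂ K] {J H : K →L[ℂ] K}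
    (hJ : IsFundamentalSymmetry J) (hH : IsJHermitian J H) :
    globalSignature J H =
      (Module.finrank ℂ (plusSpace J) : ℤ) - (Module.finrank ℂ (minusSpace J) : ℤ) := by
  set E : ℂ → Submodule ℂ K := fun a => Module.End.maxGenEigenspace (H : Module.End ℂ K) a with hE
  have htop : ⨆ a, E a = ⊤ := Module.End.iSup_maxGenEigenspace_eq_top (H : Module.End ℂ K)
  have horth : ∀ a b : ℂ, b ≠ starRingEnd ℂ a → ∀ v ∈ E a, ∀ w ∈ E b, ⟪v, J w⟫_ℂ = 0 :=
    fun a b hab v hv w hw => inner_maxGenEigenspace_eq_zero hH hab hw hv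
  have hfin : {t : ℝ | Module.End.HasEigenvalue (H : Module.End ℂ K) (t : ℂ)}.Finite :=
    (Module.End.finite_hasEigenvalue (H : Module.End ℂ K)).preimage
      Complex.ofReal_injective.injOn
  have hbot : ∀ t : ℝ, t ∉ hfin.toFinset → E t = ⊥ := fun t ht =>
    maxGenEigenspace_eq_bot_of_not_hasEigenvalue fun h => ht (hfin.mem_toFinset.2 h)
  set R : Submodule ℂ K := hfin.toFinset.sup fun t : ℝ => E t with hR
  set U : Submodule ℂ K := ⨆ a : {a : ℂ // 0 < a.im}, E a with hU
  set L : Submodule ℂ K := ⨆ a : {a : ℂ // a.im < 0}, E a with hL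
  have hRle : R ≤ ⨆ t : ℝ, E t :=
    Finset.sup_le fun t _ => le_iSup (fun t : ℝ => E t) t
  have hsum : R ⊔ (U ⊔ L) = ⊤ := by
    rw [eq_top_iff, ← htop]
    refine iSup_le fun a => ?_
    rcases lt_trichotomy a.im 0 with h | h | h
    · exact le_sup_of_le_right (le_sup_of_le_right
        (le_iSup (fun a : {a : ℂ // a.im < 0} => E a) ⟨a, h⟩))
    · obtain ⟨t, rfl⟩ : ∃ t : ℝ, (t : ℂ) = a := ⟨a.re, Complex.ext rfl h.symm⟩
      by_cases ht : t ∈ hfin.toFinset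
      · exact le_sup_of_le_left (Finset.le_sup (f := fun t : ℝ => E t) ht)
      · rw [hbot t ht]
        exact bot_le
    · exact le_sup_of_le_right (le_sup_of_le_left
        (le_iSup (fun a : {a : ℂ // 0 < a.im} => E a) ⟨a, h⟩))
  -- Conjugate numbers have opposite imaginary parts, so this one criterion covers all pairings
  -- among `U`, `L` and `R` except `U` with `L` and `R` with itself.
  have hne : ∀ a b : ℂ, a.im + b.im ≠ 0 → b ≠ starRingEnd ℂ a := by
    rintro a b h rfl
    exact h (by simp)
  have hUU : ∀ v ∈ U, ∀ w ∈ U, ⟪v, J w⟫_ℂ = 0 :=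
    inner_iSup_eq_zero hJ.1 fun a b => horth a b (hne _ _ (add_pos a.2 b.2).ne')
  have hLL : ∀ v ∈ L, ∀ w ∈ L, ⟪v, J w⟫_ℂ = 0 :=
    inner_iSup_eq_zero hJ.1 fun a b => horth a b (hne _ _ (add_neg a.2 b.2).ne)
  have hUR : ∀ v ∈ U, ∀ w ∈ R, ⟪v, J w⟫_ℂ = 0 := fun v hv w hw =>
    inner_iSup_eq_zero hJ.1 (V := fun a : {a : ℂ // 0 < a.im} => E a) (W := fun t : ℝ => E t)
      (fun a b => horth a b (hne _ _ (by simpa using a.2.ne'))) v hv w (hRle hw)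
  have hLR : ∀ v ∈ L, ∀ w ∈ R, ⟪v, J w⟫_ℂ = 0 := fun v hv w hw =>
    inner_iSup_eq_zero hJ.1 (V := fun a : {a : ℂ // a.im < 0} => E a) (W := fun t : ℝ => E t)
      (fun a b => horth a b (hne _ _ (by simpa using a.2.ne))) v hv w (hRle hw)
  have hULR : ∀ v ∈ U ⊔ L, ∀ w ∈ R, ⟪v, J w⟫_ℂ = 0 := by
    intro v hv w hw
    obtain ⟨x, hx, y, hy, rfl⟩ := Submodule.mem_sup.1 hv
    rw [inner_add_left, hUR x hx w hw, hLR y hy w hw, add_zero]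
  have hRUL : ∀ v ∈ R, ∀ w ∈ U ⊔ L, ⟪v, J w⟫_ℂ = 0 := fun v hv w hw =>
    inner_apply_symm hJ.1 (hULR w hw v hv)
  have hndE : ∀ t : ℝ, formEigenspace J (E t) 0 = ⊥ := by
    intro t
    -- A real `t` is its own conjugate, so all the other generalized eigenspaces form a
    -- `J`-orthogonal complement of `E t`.
    refine formEigenspace_zero_of_sup_eq_top hJ (W := ⨆ a : {a : ℂ // a ≠ t}, E a) ?_ ?_
    · rw [eq_top_iff, ← htop]
      refine iSup_le fun a => ?_
      by_cases h : a = t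
      · rw [h]
        exact le_sup_left
      · exact le_sup_of_le_right (le_iSup (fun a : {a : ℂ // a ≠ t} => E a) ⟨a, h⟩)
    · intro v hv
      exact inner_iSup_right_eq_zero fun b => horth t b (by
        rw [Complex.conj_ofReal]
        exact b.2) v hv
  obtain ⟨hndR, hsigR⟩ := formSignature_finset_sup hJ.1 hfin.toFinset (fun t : ℝ => E t)
    (fun t _ => hndE t) fun s _ t _ hst => horth s t (by
      rw [Complex.conj_ofReal]
      exact fun h => hst (Complex.ofReal_injective h).symm)
  have hndUL : formEigenspace J (U ⊔ L) 0 = ⊥ :=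
    formEigenspace_zero_of_sup_eq_top hJ (by rw [sup_comm, hsum]) hULR
  have hterm : ∀ t : ℝ, kreinSignature J H t = formSignature J (E t) := fun t => by
    rw [kreinSignature, spectralSpace_eq_maxGenEigenspace, formSignature]
  have hglobal : globalSignature J H = ∑ t ∈ hfin.toFinset, formSignature J (E t) := by
    rw [globalSignature, finsum_congr hterm]
    refine finsum_eq_sum_of_support_subset _ fun t ht => ?_
    by_contra h
    refine ht ?_
    change formSignature J (E t) = 0
    rw [hbot t h, formSignature_bot]
  rw [hglobal, ← hsigR, ← formSignature_top hJ, ← hsum, formSignature_sup hJ.1 hndR hndUL hRUL,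
    formSignature_sup_of_isotropic hJ.1 hUU hLL hndUL, add_zero]

end Signature

end Krein

theorem mainTheorem7 {K : Type*} [NormedAddCommGroup K] [InnerProductSpace ℂ K]
    [CompleteSpace K] [TopologicalSpace.SeparableSpace K]
    (J : K →L[ℂ] K) (hJ : Krein.IsFundamentalSymmetry J) :
    (FiniteDimensional ℂ (Krein.plusSpace J) → FiniteDimensional ℂ (Krein.minusSpace J) →
      Krein.realFredholm J =
        Krein.realFredholmOfSignature J
          ((Module.finrank ℂ (Krein.plusSpace J) : ℤ) -
            (Module.finrank ℂ (Krein.minusSpace J) : ℤ))) ∧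
    ((FiniteDimensional ℂ (Krein.plusSpace J) ∧ ¬ FiniteDimensional ℂ (Krein.minusSpace J)) ∨
        (¬ FiniteDimensional ℂ (Krein.plusSpace J) ∧ FiniteDimensional ℂ (Krein.minusSpace J)) →
      Krein.realFredholm J = ∅) := by
  refine ⟨fun hp hm => ?_, Krein.realFredholm_eq_empty hJ⟩
  have htop : FiniteDimensional ℂ (⊤ : Submodule ℂ K) := by
    rw [← hJ.sup_eq_top]
    infer_instance
  have : FiniteDimensional ℂ K := Module.Finite.equiv Submodule.topEquiv
  exact Set.ext fun H => ⟨fun hH => ⟨hH, Krein.globalSignature_eq hJ hH.1⟩, fun hH => hH.1⟩
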